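/- (In ZFC.) There exist two countably compact Hausdorff topological groups $\mathbb G_0$ and $\mathbb G_1$ whose product $\mathbb G_0\times\mathbb G_1$, with the product topology, is not countably compact. Here a Hausdorff space is called countably compact if each of its infinite subsets has an accumulation point in the space (equivalently, if each of its countable open covers has a finite subcover). -/

import Mathlib

open Set Filter Topology

/-! Over the field with two elements, each label b spans a Boolean group on its own generators,
topologized by the functionals for which each limit generator with independent partial sums really
is their limit along an ultrafilter attached to it. A sequence of formal sums with infinite range
has a linearly independent subsequence, and some generator with label b is its limit; this gives
countable compactness.

If these functionals separate formal sums (`eval_injective`), the two groups share only the span of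
the `base n`. Functionals take arbitrary values there, so the diagonal sequence of the `base n` has
no cluster point in the product.

For separation, put the support of d ≠ 0 in a countable closed set, build a functional for that set
(`exists_linearMap_eventually_eq_zero`), and extend it by ultrafilter limits. The ultrafilters live
on almost disjoint unions of blocks, each block so long that a greedy choice avoiding d loses only a
negligible part of it. -/

/-- Points of a countably branching well-founded tree: free generators `base n`, and generators
`lim b c s` intended as limits of the sums `∑ j ∈ c n, s j`; the label `b` records which of two
groups the generator belongs to. -/
inductive Gen : Type
  | base : ℕ → Gen
  | lim : Bool → (ℕ → Finset ℕ) → (ℕ → Gen) → Gen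

/-! ### Generators and formal sums -/

namespace Gen

/-- The arities of the W-type used to bound the cardinality of `Gen`. -/
def Arity : ℕ ⊕ (Bool × (ℕ → Finset ℕ)) → Type
  | .inl _ => Empty
  | .inr _ => ℕ

/-- `Gen` as a W-type. -/
def toWType : Gen → WType Arity
  | base n => ⟨.inl n, Empty.elim⟩
  | lim b c s => ⟨.inr (b, c), fun j : ℕ => (s j).toWType⟩

theorem toWType_injective : Function.Injective toWType := by
  intro x
  induction x with
  | base n =>
    rintro (m | ⟨b, c, s⟩) h
    · injection h with h
      rw [Sum.inl.inj h]
    · injection h with h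
      cases h
  | lim b c s ih =>
    rintro (m | ⟨b', c', s'⟩) h
    · injection h with h
      cases h
    · injection h with h h'
      cases h
      have : s = s' := funext fun j => ih j (congrFun h' j)
      rw [this]

open Cardinal in
theorem mk_le_continuum : #Gen ≤ 𝔠 := by
  refine (mk_le_of_injective toWType_injective).trans (WType.cardinalMk_le_of_le' ?_)
  have h1 : #(ℕ → Finset ℕ) = 𝔠 := by simp
  have h2 : #(Bool × (ℕ → Finset ℕ)) = 𝔠 := by
    rw [mk_prod, h1]; simp
  have h : ∀ a, 𝔠 ^ #(Arity a) ≤ 𝔠 := by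
    rintro (n | a)
    · have : #(Arity (.inl n)) = 0 := mk_eq_zero Empty
      rw [this, power_zero]
      exact (nat_lt_continuum 1).le.trans' (by simp)
    · have : #(Arity (.inr a)) = ℵ₀ := mk_nat
      rw [this, continuum_power_aleph0]
  simp only [lift_id]
  refine (sum_le_sum _ _ h).trans ?_
  rw [sum_const', mk_sum, h2]
  simp

/-- Allows an almost disjoint family of subsets of ℕ to be indexed by the generators. -/
theorem exists_injective : ∃ r : Gen → ℕ → Bool, Function.Injective r := by
  have : Cardinal.mk Gen ≤ Cardinal.mk (ℕ → Bool) := by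
    simpa using mk_le_continuum
  exact ⟨_, (Classical.choice this).injective⟩

theorem child_ne_lim (b : Bool) (c : ℕ → Finset ℕ) (s : ℕ → Gen) (j : ℕ) : s j ≠ lim b c s := by
  have key : ∀ x : Gen, ∀ b c s, x = lim b c s → ∀ j, s j ≠ x := by
    intro x
    induction x with
    | base n => intro b c s h; cases h
    | lim b c s ih =>
      intro b' c' s' h j hj
      cases h
      exact ih j b c s hj j rfl
  exact key _ b c s rfl j

/-- Sets of generators closed under passing to children. -/
def Closed (D : Set Gen) : Prop := ∀ b c s, lim b c s ∈ D → ∀ j, s j ∈ D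

theorem exists_countable_closed (x : Gen) : ∃ D : Set Gen, D.Countable ∧ Closed D ∧ x ∈ D := by
  induction x with
  | base n =>
    refine ⟨{base n}, countable_singleton _, fun b c s h => ?_, rfl⟩
    cases mem_singleton_iff.1 h
  | lim b c s ih =>
    choose D hD hcl hmem using ih
    refine ⟨insert (lim b c s) (⋃ j, D j), (countable_iUnion hD).insert _, ?_, mem_insert _ _⟩
    rintro b' c' s' (h | h) j
    · cases h
      exact Or.inr (mem_iUnion.2 ⟨j, hmem j⟩)
    · obtain ⟨i, hi⟩ := mem_iUnion.1 h
      exact Or.inr (mem_iUnion.2 ⟨i, hcl i _ _ _ hi j⟩)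

theorem exists_countable_closed_superset (F : Set Gen) (hF : F.Countable) :
    ∃ D : Set Gen, D.Countable ∧ Closed D ∧ F ⊆ D := by
  choose D hD hcl hmem using exists_countable_closed
  refine ⟨⋃ x ∈ F, D x, hF.biUnion fun x _ => hD x, ?_, fun x hx => mem_biUnion hx (hmem x)⟩
  intro b c s h j
  obtain ⟨x, hx, h⟩ := mem_iUnion₂.1 h
  exact mem_biUnion hx (hcl x _ _ _ h j)

/-- The generators all of whose labels are equal to `b`. -/
def Mono (b : Bool) : Gen → Prop
  | base _ => True
  | lim b' _ s => b' = b ∧ ∀ j, (s j).Mono b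

theorem Mono.exists_base {x : Gen} (h₀ : x.Mono false) (h₁ : x.Mono true) : ∃ n, x = base n := by
  cases x with
  | base n => exact ⟨n, rfl⟩
  | lim b c s => exact absurd (h₀.1.symm.trans h₁.1) (by simp)

/-- The partial sums `∑ j ∈ c n, s j` attached to `lim b c s`. -/
noncomputable def term (c : ℕ → Finset ℕ) (s : ℕ → Gen) (n : ℕ) : Gen →₀ ZMod 2 :=
  ∑ j ∈ c n, Finsupp.single (s j) 1

/-- The difference (in characteristic two) between `lim b c s` and its approximation. -/
noncomputable def gap (b : Bool) (c : ℕ → Finset ℕ) (s : ℕ → Gen) (n : ℕ) : Gen →₀ ZMod 2 :=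
  term c s n + Finsupp.single (lim b c s) 1

theorem linearIndependent_gap (b : Bool) {c : ℕ → Finset ℕ} {s : ℕ → Gen}
    (h : LinearIndependent (ZMod 2) (term c s)) : LinearIndependent (ZMod 2) (gap b c s) := by
  classical
  let L : (Gen →₀ ZMod 2) →ₗ[ZMod 2] (Gen →₀ ZMod 2) :=
    Finsupp.linearCombination (ZMod 2)
      fun x => if x = lim b c s then 0 else Finsupp.single x (1 : ZMod 2)
  -- `L` kills the limit generator, which is not one of its own children, so it sends gaps back to
  -- partial sums.
  refine LinearIndependent.of_comp L ?_
  convert h using 1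
  funext n
  simp [L, gap, term, child_ne_lim]

theorem exists_term_eq {S : Set Gen} (hS : base 0 ∈ S) (f : ℕ → Gen →₀ ZMod 2)
    (hf : ∀ n, ((f n).support : Set Gen) ⊆ S) :
    ∃ c s, term c s = f ∧ ∀ j, s j ∈ S := by
  classical
  -- Inserting `base 0` keeps the set to be enumerated nonempty even if every `f n` is zero.
  have hT : (insert (base 0) (⋃ n, ((f n).support : Set Gen))).Countable :=
    (countable_iUnion fun n => (f n).support.countable_toSet).insert _
  obtain ⟨s, hs⟩ := hT.exists_eq_range (insert_nonempty _ _)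
  have hidx : ∀ x n, x ∈ (f n).support → s (Function.invFun s x) = x := by
    intro x n hx
    refine Function.invFun_eq (f := s) ?_
    have : x ∈ range s := hs ▸ Or.inr (mem_iUnion.2 ⟨n, hx⟩)
    exact this
  refine ⟨fun n => (f n).support.image (Function.invFun s), s, ?_, ?_⟩
  · funext n
    rw [term, Finset.sum_image]
    · conv_rhs => rw [← Finsupp.sum_single (f n), Finsupp.sum]
      refine Finset.sum_congr rfl fun x hx => ?_
      rw [hidx x n hx]
      have : ∀ z : ZMod 2, z ≠ 0 → z = 1 := by decide
      rw [this _ (Finsupp.mem_support_iff.1 hx)]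
    · intro x hx y hy h
      rw [← hidx x n hx, ← hidx y n hy, h]
  · intro j
    have : s j ∈ insert (base 0) (⋃ n, ((f n).support : Set Gen)) := hs ▸ mem_range_self j
    rcases this with h | h
    · exact h ▸ hS
    · obtain ⟨n, hn⟩ := mem_iUnion.1 h
      exact hf n hn

end Gen

/-! ### Almost disjoint sets and block filters -/

/-- Branches of the binary tree, coded by their initial segments: distinct branches share only
finitely many. -/
theorem exists_almostDisjoint_family :
    ∃ A : (ℕ → Bool) → Set ℕ, (∀ r, (A r).Infinite) ∧ ∀ r s, r ≠ s → (A r ∩ A s).Finite := by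
  let code : (ℕ → Bool) → ℕ → ℕ := fun r n => Encodable.encode ((List.range n).map r)
  have hlen : ∀ r s m n, code r m = code s n → m = n := fun r s m n h => by
    simpa using congrArg List.length (Encodable.encode_injective h)
  refine ⟨fun r => range (code r), fun r => infinite_range_of_injective fun m n => hlen r r m n, ?_⟩
  intro r s hrs
  obtain ⟨i, hi⟩ := Function.ne_iff.1 hrs
  refine ((finite_Iic i).image (code r)).subset ?_
  rintro _ ⟨⟨m, rfl⟩, ⟨n, hn⟩⟩
  refine ⟨m, mem_Iic.2 (not_lt.1 fun him => hi ?_), rfl⟩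
  obtain rfl := hlen _ _ _ _ hn
  have := Encodable.encode_injective hn
  exact ((List.map_inj_left.1 this) i (List.mem_range.2 him)).symm

/-- The blocks `[n!, (n+1)!)` of natural numbers. -/
def factBlock (n : ℕ) : Finset ℕ := Finset.Ico n.factorial (n + 1).factorial

theorem card_factBlock (n : ℕ) : (factBlock n).card = n * n.factorial := by
  rw [factBlock, Nat.card_Ico, Nat.factorial_succ, Nat.add_mul, one_mul, Nat.add_sub_cancel]

/-- The sets missing, for some `k`, at most `k * n!` elements of almost every block with index
in `A`. -/
def blockFilter (A : Set ℕ) : Filter ℕ where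
  sets := {S | ∃ k, ∀ᶠ n in atTop, n ∈ A → ((factBlock n : Set ℕ) \ S).ncard ≤ k * n.factorial}
  univ_sets := ⟨0, by simp⟩
  sets_of_superset := by
    rintro S T ⟨k, hk⟩ hST
    refine ⟨k, hk.mono fun n h hn => (ncard_le_ncard (sdiff_subset_sdiff_right hST)
      ((factBlock n).finite_toSet.subset sdiff_subset)).trans (h hn)⟩
  inter_sets := by
    rintro S T ⟨k, hk⟩ ⟨l, hl⟩
    refine ⟨k + l, (hk.and hl).mono fun n h hn => ?_⟩
    rw [sdiff_inter, add_mul]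
    exact (ncard_union_le _ _).trans (add_le_add (h.1 hn) (h.2 hn))

theorem mem_blockFilter {A S : Set ℕ} : S ∈ blockFilter A ↔
    ∃ k, ∀ᶠ n in atTop, n ∈ A → ((factBlock n : Set ℕ) \ S).ncard ≤ k * n.factorial := Iff.rfl

theorem blockFilter_neBot {A : Set ℕ} (hA : A.Infinite) : (blockFilter A).NeBot := by
  rw [← empty_mem_iff_bot.not.trans neBot_iff.symm, mem_blockFilter]
  rintro ⟨k, hk⟩
  obtain ⟨n, hn, h, hkn⟩ := ((Nat.frequently_atTop_iff_infinite.2 hA).and_eventually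
    (hk.and (eventually_gt_atTop k))).exists
  have := h hn
  rw [sdiff_empty, ncard_coe_finset, card_factBlock] at this
  exact absurd (Nat.le_of_mul_le_mul_right this n.factorial_pos) (not_le.2 hkn)

theorem blockFilter_le_atTop (A : Set ℕ) : blockFilter A ≤ atTop := by
  refine atTop_basis.ge_iff.2 fun N _ => mem_blockFilter.2 ⟨0, ?_⟩
  filter_upwards [eventually_ge_atTop N] with n hn _
  have : (factBlock n : Set ℕ) \ Ici N = ∅ := by
    rw [sdiff_eq_empty]
    intro j hj
    have := (Finset.mem_Ico.1 hj).1
    exact hn.trans ((Nat.self_le_factorial n).trans this)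
  simp [this]

/-! ### Greedy choice of functionals -/

section Greedy

variable {K V : Type*} [DivisionRing K] [AddCommGroup V] [Module K V]

/-- The indices at which the sequence `v` leaves the span of `d` and its earlier terms. -/
def greedySet (K : Type*) {V : Type*} [DivisionRing K] [AddCommGroup V] [Module K V]
    (d : V) (v : ℕ → V) : Set ℕ :=
  {j | v j ∉ Submodule.span K (insert d (v '' Iio j))}

/-- By exchange, if adjoining `v n` first brought `d` into the span, `v n` would lie in the span of
`d` and earlier terms, so `n` would not be greedy. -/
theorem notMem_span_greedySet {d : V} (hd : d ≠ 0) (v : ℕ → V) :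
    d ∉ Submodule.span K (v '' greedySet K d v) := by
  have key : ∀ n, d ∉ Submodule.span K (v '' (greedySet K d v ∩ Iio n)) := by
    intro n
    induction n with
    | zero => simpa using hd
    | succ n ih =>
      intro h
      by_cases hn : n ∈ greedySet K d v
      · have e : greedySet K d v ∩ Iio (n + 1) = insert n (greedySet K d v ∩ Iio n) := by
          ext j
          simp only [mem_inter_iff, mem_Iio, mem_insert_iff, Nat.lt_succ_iff_lt_or_eq]
          constructor
          · rintro ⟨h, h' | h'⟩ <;> tauto
          · rintro (rfl | h) <;> tauto
        rw [e, image_insert_eq] at h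
        have := mem_span_insert_exchange h ih
        exact hn (Submodule.span_mono (insert_subset_insert (image_mono inter_subset_right)) this)
      · have e : greedySet K d v ∩ Iio (n + 1) = greedySet K d v ∩ Iio n := by
          ext j
          simp only [mem_inter_iff, mem_Iio, Nat.lt_succ_iff_lt_or_eq]
          constructor
          · rintro ⟨h, h' | rfl⟩ <;> tauto
          · tauto
        exact ih (e ▸ h)
  intro h
  have hU : v '' greedySet K d v = ⋃ n, v '' (greedySet K d v ∩ Iio n) := by
    rw [← image_iUnion, ← inter_iUnion, iUnion_Iio, inter_univ]
  rw [hU, Submodule.span_iUnion, Submodule.mem_iSup_of_directed] at h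
  · obtain ⟨n, hn⟩ := h
    exact key n hn
  · exact Monotone.directed_le fun m n h =>
      Submodule.span_mono (image_mono (inter_subset_inter_right _ (Iio_subset_Iio h)))

theorem span_greedySet (d : V) (v : ℕ → V) (N : ℕ) : v '' Iio N ⊆
    Submodule.span K (insert d (v '' (greedySet K d v ∩ Iio N))) := by
  rintro _ ⟨i, hi, rfl⟩
  induction i using Nat.strong_induction_on with
  | _ i ih =>
    by_cases h : i ∈ greedySet K d v
    · exact Submodule.subset_span (Or.inr ⟨i, ⟨h, hi⟩, rfl⟩)
    · refine Submodule.span_le.2 ?_ (not_not.1 h)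
      rintro _ (rfl | ⟨j, hj, rfl⟩)
      · exact Submodule.subset_span (mem_insert _ _)
      · exact ih j hj (mem_Iio.2 (lt_trans (mem_Iio.1 hj) hi))

/-- Dimension count: the independent block lies in the span of its greedy terms, the n! earlier
terms and `d`, so at most n! + 1 ≤ 2 · n! indices are lost. -/
theorem ncard_factBlock_diff_greedySet_le (d : V) (v : ℕ → V) (n : ℕ)
    (hv : LinearIndepOn K v (factBlock n)) :
    ((factBlock n : Set ℕ) \ greedySet K d v).ncard ≤ 2 * n.factorial := by
  classical
  set U := greedySet K d v
  let B : Finset ℕ := (factBlock n).filter (· ∈ U)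
  let T : Finset V := insert d ((Finset.range n.factorial ∪ B).image v)
  have hT : T.card ≤ B.card + n.factorial + 1 := by
    refine (Finset.card_insert_le _ _).trans (Nat.succ_le_succ ?_)
    refine Finset.card_image_le.trans ((Finset.card_union_le _ _).trans ?_)
    rw [Finset.card_range, add_comm]
  have hsub : v '' factBlock n ⊆ Submodule.span K (T : Set V) := by
    refine (image_mono ?_).trans ((span_greedySet (K := K) d v (n + 1).factorial).trans
      (Submodule.span_mono ?_))
    · intro j hj
      exact (Finset.mem_Ico.1 hj).2
    · rintro _ (rfl | ⟨j, ⟨hjU, hj⟩, rfl⟩)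
      · simp [T]
      · rcases lt_or_ge j n.factorial with h | h
        · simp only [T, Finset.coe_insert, Finset.coe_image]
          exact Or.inr ⟨j, by simp [h], rfl⟩
        · simp only [T, Finset.coe_insert, Finset.coe_image]
          refine Or.inr ⟨j, ?_, rfl⟩
          have : j ∈ factBlock n := Finset.mem_Ico.2 ⟨h, hj⟩
          simp only [Finset.coe_union, mem_union, B, Finset.mem_coe, Finset.mem_filter]
          exact Or.inr ⟨this, hjU⟩
  have hcard : (factBlock n).card ≤ T.card := by
    have h1 := LinearIndependent.fintype_card_le_finrank
      (M := Submodule.span K (T : Set V)) (R := K)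
      (b := fun j : (factBlock n : Set ℕ) => ⟨v j, hsub ⟨j, j.2, rfl⟩⟩)
      (LinearIndependent.of_comp (Submodule.subtype _) hv)
    have h2 := finrank_span_finset_le_card (R := K) T
    simpa using h1.trans h2
  have hsplit : (factBlock n : Set ℕ) \ U = ((factBlock n).filter (· ∉ U) : Finset ℕ) := by
    ext j; simp
  rw [hsplit, ncard_coe_finset]
  have := Finset.card_filter_add_card_filter_not (s := factBlock n) (· ∈ U)
  have := n.factorial_pos
  simp only [B] at hT
  omega

end Greedy

theorem factBlock_index_unique {m n j : ℕ} (hm : j ∈ factBlock m) (hn : j ∈ factBlock n) :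
    m = n := by
  rw [factBlock, Finset.mem_Ico] at hm hn
  by_contra hne
  rcases lt_or_gt_of_ne hne with h | h
  · exact absurd (hm.2.trans_le ((Nat.factorial_le h).trans hn.1)) (lt_irrefl _)
  · exact absurd (hn.2.trans_le ((Nat.factorial_le h).trans hm.1)) (lt_irrefl _)

theorem exists_linearMap_eventually_eq_zero {K V X : Type*} [Field K] [AddCommGroup V] [Module K V]
    {A : X → Set ℕ} (hA : ∀ x y, x ≠ y → (A x ∩ A y).Finite) {D : Set X} (hD : D.Countable)
    {g : X → ℕ → V} (hg : ∀ x ∈ D, LinearIndependent K (g x)) {d : V} (hd : d ≠ 0) :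
    ∃ Φ : V →ₗ[K] K, Φ d ≠ 0 ∧ ∀ x ∈ D, ∀ᶠ n in blockFilter (A x), Φ (g x n) = 0 := by
  classical
  obtain ⟨e, he⟩ := countable_iff_exists_injOn.1 hD
  -- Block n goes to the first x in the enumeration of `D` with n ∈ `A x`; by almost disjointness, x
  -- receives almost all blocks indexed by `A x`.
  let Owns : X → ℕ → Prop := fun x n => x ∈ D ∧ n ∈ A x ∧ ∀ y ∈ D, e y < e x → n ∉ A y
  have owns_unique : ∀ x y n, Owns x n → Owns y n → x = y := by
    rintro x y n ⟨hx, hxA, hxm⟩ ⟨hy, hyA, hym⟩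
    refine he hx hy (le_antisymm ?_ ?_)
    · exact not_lt.1 fun h => hxm y hy h hyA
    · exact not_lt.1 fun h => hym x hx h hxA
  have owns_eventually : ∀ x ∈ D, ∀ᶠ n in atTop, n ∈ A x → Owns x n := by
    intro x hx
    have hfin : {y ∈ D | e y < e x}.Finite :=
      Finite.of_finite_image ((finite_Iio (e x)).subset (by rintro _ ⟨y, hy, rfl⟩; exact hy.2))
        (he.mono fun y hy => hy.1)
    have : ∀ᶠ n in atTop, ∀ y ∈ {y ∈ D | e y < e x}, ¬ (n ∈ A x ∩ A y) := by
      rw [eventually_all_finite hfin]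
      rintro y ⟨-, hy⟩
      rw [← Nat.cofinite_eq_atTop]
      exact (hA x y fun h => absurd hy (h ▸ lt_irrefl _)).eventually_cofinite_notMem
    filter_upwards [this] with n hn hnx
    exact ⟨hx, hnx, fun y hy hlt hny => hn y ⟨hy, hlt⟩ ⟨hnx, hny⟩⟩
  -- Splice the sequences into one, following `g x` on the blocks owned by x.
  let v : ℕ → V := fun j =>
    if h : ∃ x n, Owns x n ∧ j ∈ factBlock n then g h.choose j else 0
  have hv : ∀ x n j, Owns x n → j ∈ factBlock n → v j = g x j := by
    intro x n j hx hj
    have h : ∃ x n, Owns x n ∧ j ∈ factBlock n := ⟨x, n, hx, hj⟩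
    obtain ⟨m, hm, hjm⟩ := h.choose_spec
    rw [factBlock_index_unique hjm hj] at hm
    simp only [v, dif_pos h, owns_unique _ _ _ hm hx]
  obtain ⟨Φ, hΦd, hΦ⟩ := Submodule.exists_le_ker_of_notMem (notMem_span_greedySet (K := K) hd v)
  refine ⟨Φ, hΦd, fun x hx => mem_blockFilter.2 ⟨2, ?_⟩⟩
  filter_upwards [owns_eventually x hx] with n hn hnx
  have hown := hn hnx
  have hLI : LinearIndepOn K v (factBlock n) :=
    (((hg x hx).linearIndepOn (factBlock n)).congr fun j hj => (hv x n j hown hj).symm)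
  refine (ncard_le_ncard ?_ ((factBlock n).finite_toSet.subset sdiff_subset)).trans
    (ncard_factBlock_diff_greedySet_le d v n hLI)
  rintro j ⟨hj, hΦj⟩
  refine ⟨hj, fun hjU => hΦj ?_⟩
  have := hΦ (Submodule.subset_span ⟨j, hjU, rfl⟩)
  rw [hv x n j hown hj] at this
  exact this

/-! ### Functionals respecting limits -/

namespace Gen

/-- A family of ultrafilters along which the relations between limit generators and their
approximations can be satisfied by functionals separating points, over countable sets. -/
theorem exists_separating_ultrafilters : ∃ p : Gen → Ultrafilter ℕ,
    (∀ x, (p x : Filter ℕ) ≤ atTop) ∧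
    ∀ D : Set Gen, D.Countable → ∀ d : Gen →₀ ZMod 2, d ≠ 0 →
      ∃ Φ : (Gen →₀ ZMod 2) →ₗ[ZMod 2] ZMod 2, Φ d ≠ 0 ∧
        ∀ b c s, lim b c s ∈ D → LinearIndependent (ZMod 2) (gap b c s) →
          ∀ᶠ n in p (lim b c s), Φ (gap b c s n) = 0 := by
  obtain ⟨r, hr⟩ := exists_injective
  obtain ⟨A, hinf, hdisj⟩ := exists_almostDisjoint_family
  have := fun x => blockFilter_neBot (hinf (r x))
  refine ⟨fun x => Ultrafilter.of (blockFilter (A (r x))),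
    fun x => (Ultrafilter.of_le _).trans (blockFilter_le_atTop _), fun D hD d hd => ?_⟩
  let g : Gen → ℕ → Gen →₀ ZMod 2 := fun x =>
    match x with
    | base _ => 0
    | lim b c s => gap b c s
  obtain ⟨Φ, hΦd, hΦ⟩ := exists_linearMap_eventually_eq_zero (K := ZMod 2) (A := fun x => A (r x))
    (fun x y hxy => hdisj _ _ (hr.ne hxy)) (g := g)
    (hD.mono (sep_subset D fun x => LinearIndependent (ZMod 2) (g x))) (fun x hx => hx.2) hd
  exact ⟨Φ, hΦd, fun b c s hmem hLI => Ultrafilter.of_le _ (hΦ (lim b c s) ⟨hmem, hLI⟩)⟩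

/-- The linear functional determined by `Ψ` respects all limits of independent sequences. -/
def RespectsLimits (p : Gen → Ultrafilter ℕ) (Ψ : Gen → ZMod 2) : Prop :=
  ∀ b c s, LinearIndependent (ZMod 2) (gap b c s) →
    ∀ᶠ n in p (lim b c s), Finsupp.linearCombination (ZMod 2) Ψ (gap b c s n) = 0

theorem linearCombination_gap (Ψ : Gen → ZMod 2) (b : Bool) (c : ℕ → Finset ℕ) (s : ℕ → Gen)
    (n : ℕ) : Finsupp.linearCombination (ZMod 2) Ψ (gap b c s n) =
      ∑ j ∈ c n, Ψ (s j) + Ψ (lim b c s) := by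
  simp [gap, term]

/-- The limit along an ultrafilter of a sequence of elements of `ZMod 2`. -/
noncomputable def ultraLim (p : Ultrafilter ℕ) (h : ℕ → ZMod 2) : ZMod 2 :=
  open Classical in if ∀ᶠ n in p, h n = 1 then 1 else 0

theorem eventually_eq_ultraLim (p : Ultrafilter ℕ) (h : ℕ → ZMod 2) :
    ∀ᶠ n in p, h n = ultraLim p h := by
  unfold ultraLim
  split_ifs with H
  · exact H
  · have h01 : ∀ z : ZMod 2, z ≠ 1 → z = 0 := by decide
    exact (Ultrafilter.eventually_not.2 H).mono fun n hn => h01 _ hn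

open Classical in
/-- The extension of `Φ` from `D` to all generators by taking limits. -/
noncomputable def extend (p : Gen → Ultrafilter ℕ) (D : Set Gen) (Φ : Gen → ZMod 2) : Gen → ZMod 2
  | base n => Φ (base n)
  | lim b c s => if lim b c s ∈ D then Φ (lim b c s) else
      ultraLim (p (lim b c s)) fun n => ∑ j ∈ c n, extend p D Φ (s j)

theorem extend_of_mem {p : Gen → Ultrafilter ℕ} {D : Set Gen} {Φ : Gen → ZMod 2} {x : Gen}
    (hx : x ∈ D) : extend p D Φ x = Φ x := by
  cases x with
  | base n => rw [extend]
  | lim b c s => rw [extend, if_pos hx]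

/-- Inside `D` the children also lie in `D`, so nothing changes; outside, the value was defined as
the required limit. -/
theorem respectsLimits_extend {p : Gen → Ultrafilter ℕ} {D : Set Gen} (hD : Closed D)
    {Φ : Gen → ZMod 2} (hΦ : ∀ b c s, lim b c s ∈ D → LinearIndependent (ZMod 2) (gap b c s) →
      ∀ᶠ n in p (lim b c s), Finsupp.linearCombination (ZMod 2) Φ (gap b c s n) = 0) :
    RespectsLimits p (extend p D Φ) := by
  intro b c s hLI
  by_cases hmem : lim b c s ∈ D
  · filter_upwards [hΦ b c s hmem hLI] with n hn
    rw [linearCombination_gap] at hn ⊢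
    rw [extend_of_mem hmem, ← hn]
    congr 1
    exact Finset.sum_congr rfl fun j _ => extend_of_mem (hD b c s hmem j)
  · filter_upwards [eventually_eq_ultraLim (p (lim b c s))
      fun n => ∑ j ∈ c n, extend p D Φ (s j)] with n hn
    rw [linearCombination_gap, hn, extend, if_neg hmem]
    exact CharTwo.add_self_eq_zero _

theorem exists_respectsLimits_base (p : Gen → Ultrafilter ℕ) (φ : ℕ → ZMod 2) :
    ∃ Ψ, RespectsLimits p Ψ ∧ ∀ n, Ψ (base n) = φ n := by
  let Φ : Gen → ZMod 2 := fun x =>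
    match x with
    | base n => φ n
    | lim _ _ _ => 0
  exact ⟨extend p ∅ Φ, respectsLimits_extend (fun _ _ _ h => absurd h (notMem_empty _))
    fun _ _ _ h => absurd h (notMem_empty _), fun n => by rw [extend]⟩

theorem exists_respectsLimits_ne_zero {p : Gen → Ultrafilter ℕ}
    (hp : ∀ D : Set Gen, D.Countable → ∀ d : Gen →₀ ZMod 2, d ≠ 0 →
      ∃ Φ : (Gen →₀ ZMod 2) →ₗ[ZMod 2] ZMod 2, Φ d ≠ 0 ∧
        ∀ b c s, lim b c s ∈ D → LinearIndependent (ZMod 2) (gap b c s) →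
          ∀ᶠ n in p (lim b c s), Φ (gap b c s n) = 0)
    {d : Gen →₀ ZMod 2} (hd : d ≠ 0) :
    ∃ Ψ, RespectsLimits p Ψ ∧ Finsupp.linearCombination (ZMod 2) Ψ d ≠ 0 := by
  obtain ⟨D, hD, hcl, hsub⟩ := exists_countable_closed_superset d.support d.support.countable_toSet
  obtain ⟨Φ, hΦd, hΦ⟩ := hp D hD d hd
  have hlc : Finsupp.linearCombination (ZMod 2) (fun x => Φ (Finsupp.single x 1)) = Φ := by
    ext x; simp
  refine ⟨extend p D fun x => Φ (Finsupp.single x 1), respectsLimits_extend hcl ?_, ?_⟩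
  · rwa [hlc]
  · convert hΦd using 1
    conv_rhs => rw [← hlc]
    rw [Finsupp.linearCombination_apply, Finsupp.linearCombination_apply]
    exact Finset.sum_congr rfl fun x hx => by simp only [extend_of_mem (hsub hx)]

end Gen

/-! ### The two groups and their product -/

/-- Finite-dimensional spaces over a finite field are finite, so an infinite range contains an
infinite independent set. -/
theorem exists_injective_linearIndependent_comp {K V : Type*} [Field K] [Finite K] [AddCommGroup V]
    [Module K V] {f : ℕ → V} (hf : (range f).Infinite) :
    ∃ φ : ℕ → ℕ, Function.Injective φ ∧ LinearIndependent K (f ∘ φ) := by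
  obtain ⟨b, hb, hspan, hLI⟩ := exists_linearIndependent K (range f)
  have hinf : b.Infinite := by
    intro hfin
    have : Module.Finite K (Submodule.span K b) := Module.Finite.span_of_finite K hfin
    have : Finite (Submodule.span K b) := Module.finite_of_finite K
    exact hf ((toFinite (Submodule.span K b : Set V)).subset (hspan ▸ Submodule.subset_span))
  have := hinf.to_subtype
  obtain ⟨i⟩ : Nonempty (ℕ ↪ b) := ⟨Infinite.natEmbedding b⟩
  choose φ hφ using fun n => hb (i n).2
  refine ⟨φ, fun m n h => i.injective (Subtype.ext ?_), ?_⟩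
  · rw [← hφ m, ← hφ n, h]
  · have : f ∘ φ = ((↑) : b → V) ∘ i := funext hφ
    rw [this]
    exact hLI.comp i i.injective

theorem exists_mapClusterPt_of_finite_range {E : Type*} [TopologicalSpace E] {x : ℕ → E}
    (h : (range x).Finite) : ∃ n, MapClusterPt (x n) atTop x := by
  have : ∃ᶠ n in atTop, ∃ a ∈ range x, x n = a :=
    (Eventually.of_forall fun n => ⟨x n, mem_range_self n, rfl⟩).frequently
  obtain ⟨_, ⟨n, rfl⟩, hn⟩ := (frequently_exists_finite h).1 this
  exact ⟨n, mapClusterPt_iff_frequently.2 fun s hs =>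
    hn.mono fun m hm => hm ▸ mem_of_mem_nhds hs⟩

namespace Gen

/-- The evaluation of formal sums of generators at the limit-respecting functionals. -/
noncomputable def eval (p : Gen → Ultrafilter ℕ) :
    (Gen →₀ ZMod 2) →ₗ[ZMod 2] ({Ψ // RespectsLimits p Ψ} → ZMod 2) :=
  LinearMap.pi fun Ψ => Finsupp.linearCombination (ZMod 2) Ψ.1

/-- The group generated by the generators with all labels equal to `b`, with the topology of
pointwise convergence on the limit-respecting functionals. -/
noncomputable def monoGroup (p : Gen → Ultrafilter ℕ) (b : Bool) :
    AddSubgroup ({Ψ // RespectsLimits p Ψ} → ZMod 2) :=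
  ((Finsupp.supported (ZMod 2) (ZMod 2) {x : Gen | x.Mono b}).map (eval p)).toAddSubgroup

theorem mem_monoGroup {p : Gen → Ultrafilter ℕ} {b : Bool}
    {z : {Ψ // RespectsLimits p Ψ} → ZMod 2} : z ∈ monoGroup p b ↔
      ∃ v : Gen →₀ ZMod 2, (v.support : Set Gen) ⊆ {x | x.Mono b} ∧ eval p v = z := Iff.rfl

theorem tendsto_eval_term (p : Gen → Ultrafilter ℕ) (b : Bool) {c : ℕ → Finset ℕ} {s : ℕ → Gen}
    (h : LinearIndependent (ZMod 2) (term c s)) :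
    Tendsto (fun n => eval p (term c s n)) (p (lim b c s))
      (𝓝 (eval p (Finsupp.single (lim b c s) 1))) := by
  refine tendsto_pi_nhds.2 fun Ψ => tendsto_nhds_of_eventually_eq ?_
  filter_upwards [Ψ.2 b c s (linearIndependent_gap b h)] with n hn
  rw [gap, map_add] at hn
  exact CharTwo.add_eq_zero.1 hn

theorem isCountablyCompact_monoGroup {p : Gen → Ultrafilter ℕ}
    (hp : ∀ x, (p x : Filter ℕ) ≤ atTop) (b : Bool) :
    IsCountablyCompact (monoGroup p b : Set ({Ψ // RespectsLimits p Ψ} → ZMod 2)) := by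
  refine isCountablyCompact_iff_seq_clusterPt.2 fun z hz => ?_
  have hlift : ∀ n, ∃ v : Gen →₀ ZMod 2, (v.support : Set Gen) ⊆ {x | x.Mono b} ∧
      (z n ∈ monoGroup p b → eval p v = z n) := by
    intro n
    by_cases h : z n ∈ monoGroup p b
    · obtain ⟨v, hv, hvz⟩ := mem_monoGroup.1 h
      exact ⟨v, hv, fun _ => hvz⟩
    · exact ⟨0, by simp, fun h' => absurd h' h⟩
  choose u hu huz using hlift
  have heq : (fun n => eval p (u n)) =ᶠ[atTop] z := hz.mono fun n hn => huz n hn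
  suffices ∃ v : Gen →₀ ZMod 2, (v.support : Set Gen) ⊆ {x | x.Mono b} ∧
      MapClusterPt (eval p v) atTop fun n => eval p (u n) by
    obtain ⟨v, hv, hcl⟩ := this
    refine ⟨eval p v, mem_monoGroup.2 ⟨v, hv, rfl⟩, ?_⟩
    rwa [MapClusterPt, ← map_congr heq]
  by_cases hfin : (range u).Finite
  · obtain ⟨n, hn⟩ := exists_mapClusterPt_of_finite_range (x := fun n => eval p (u n))
      ((hfin.image (eval p)).subset (by rintro _ ⟨m, rfl⟩; exact ⟨u m, ⟨m, rfl⟩, rfl⟩))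
    exact ⟨u n, hu n, hn⟩
  · obtain ⟨φ, hφ, hLI⟩ := exists_injective_linearIndependent_comp (K := ZMod 2) hfin
    obtain ⟨c, s, hcs, hs⟩ := exists_term_eq (S := {x | x.Mono b}) trivial (u ∘ φ)
      fun n => hu (φ n)
    refine ⟨Finsupp.single (lim b c s) 1, ?_, ?_⟩
    · refine (Finset.coe_subset.2 Finsupp.support_single_subset).trans ?_
      rw [Finset.coe_singleton, singleton_subset_iff]
      exact ⟨rfl, hs⟩
    · have h := tendsto_eval_term p b (hcs ▸ hLI)
      rw [hcs] at h
      -- `φ` need not be monotone: injectivity already makes it tend to infinity.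
      exact (h.mapClusterPt.mono (map_mono (hp _))).of_comp hφ.nat_tendsto_atTop

theorem not_countablyCompactSpace_prod_monoGroup {p : Gen → Ultrafilter ℕ}
    (hp : Function.Injective (eval p)) :
    ¬ CountablyCompactSpace (monoGroup p false × monoGroup p true) := by
  intro hcc
  let e : ℕ → {Ψ // RespectsLimits p Ψ} → ZMod 2 := fun n => eval p (Finsupp.single (base n) 1)
  have he : ∀ b n, e n ∈ monoGroup p b := fun b n => mem_monoGroup.2
    ⟨_, (Finset.coe_subset.2 Finsupp.support_single_subset).trans
      (by rw [Finset.coe_singleton, singleton_subset_iff]; exact trivial), rfl⟩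
  obtain ⟨⟨⟨x, hx⟩, ⟨y, hy⟩⟩, -, hcl⟩ := isCountablyCompact_iff_seq_clusterPt.1
    hcc.isCountablyCompact_univ (fun n => (⟨e n, he _ n⟩, ⟨e n, he _ n⟩))
    (Eventually.of_forall fun n => mem_univ _)
  -- Coordinates are discrete, so clustering means frequent equality, in both factors at once.
  have hfreq : ∀ Ψ, ∃ᶠ n in atTop, e n Ψ = x Ψ ∧ e n Ψ = y Ψ := by
    intro Ψ
    have hcont : Continuous fun q : monoGroup p false × monoGroup p true =>
        (q.1.1 Ψ, q.2.1 Ψ) :=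
      ((continuous_apply Ψ).comp (continuous_subtype_val.comp continuous_fst)).prodMk
        ((continuous_apply Ψ).comp (continuous_subtype_val.comp continuous_snd))
    have hopen : IsOpen ((fun q : monoGroup p false × monoGroup p true =>
        (q.1.1 Ψ, q.2.1 Ψ)) ⁻¹' {(x Ψ, y Ψ)}) := (isOpen_discrete _).preimage hcont
    exact (mapClusterPt_iff_frequently.1 hcl _ (hopen.mem_nhds rfl)).mono fun n hn =>
      Prod.ext_iff.1 hn
  have hxy : x = y := funext fun Ψ => by
    obtain ⟨n, h₁, h₂⟩ := (hfreq Ψ).exists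
    exact h₁.symm.trans h₂
  subst hxy
  obtain ⟨v, hv, rfl⟩ := mem_monoGroup.1 hx
  obtain ⟨w, hw, hwv⟩ := mem_monoGroup.1 hy
  obtain rfl := hp hwv
  -- `w` involves only base generators. If it is zero, the functional equal to 1 on every `base n`
  -- rules it out; otherwise the one dual to some `base m` in its support does, as it vanishes on
  -- `base n` for n > m.
  by_cases h0 : w = 0
  · obtain ⟨Ψ, hΨ, hbase⟩ := exists_respectsLimits_base p fun _ => 1
    obtain ⟨n, hn, -⟩ := (hfreq ⟨Ψ, hΨ⟩).exists
    simp [e, eval, h0, hbase] at hn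
  · obtain ⟨x, hx⟩ := Finsupp.support_nonempty_iff.2 h0
    obtain ⟨m, rfl⟩ := Mono.exists_base (hv hx) (hw hx)
    obtain ⟨Ψ, hΨ, hbase⟩ := exists_respectsLimits_base p (Pi.single m 1)
    have hval : eval p w ⟨Ψ, hΨ⟩ = w (base m) := by
      change Finsupp.linearCombination (ZMod 2) Ψ w = _
      rw [Finsupp.linearCombination_apply, Finsupp.sum, Finset.sum_eq_single (base m)]
      · simp [hbase]
      · intro y hy hne
        obtain ⟨k, rfl⟩ := Mono.exists_base (hv hy) (hw hy)
        have : k ≠ m := fun h => hne (h ▸ rfl)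
        simp [hbase, this]
      · exact fun h => absurd hx h
    obtain ⟨n, ⟨hn, -⟩, hnm⟩ := ((hfreq ⟨Ψ, hΨ⟩).and_eventually (eventually_gt_atTop m)).exists
    rw [hval] at hn
    refine Finsupp.mem_support_iff.1 hx (hn.symm.trans ?_)
    simp [e, eval, hbase, hnm.ne']

theorem eval_injective {p : Gen → Ultrafilter ℕ}
    (hp : ∀ D : Set Gen, D.Countable → ∀ d : Gen →₀ ZMod 2, d ≠ 0 →
      ∃ Φ : (Gen →₀ ZMod 2) →ₗ[ZMod 2] ZMod 2, Φ d ≠ 0 ∧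
        ∀ b c s, lim b c s ∈ D → LinearIndependent (ZMod 2) (gap b c s) →
          ∀ᶠ n in p (lim b c s), Φ (gap b c s n) = 0) :
    Function.Injective (eval p) := by
  refine (injective_iff_map_eq_zero _).2 fun d hd => by_contra fun hne => ?_
  obtain ⟨Ψ, hΨ, h⟩ := exists_respectsLimits_ne_zero hp hne
  exact h (congrFun hd ⟨Ψ, hΨ⟩)

end Gen

theorem mainTheorem2 :
    ∃ (G₀ G₁ : Type)
      (_ : Group G₀) (_ : TopologicalSpace G₀) (_ : IsTopologicalGroup G₀) (_ : T2Space G₀)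
      (_ : Group G₁) (_ : TopologicalSpace G₁) (_ : IsTopologicalGroup G₁) (_ : T2Space G₁),
      CountablyCompactSpace G₀ ∧ CountablyCompactSpace G₁ ∧
        ¬ CountablyCompactSpace (G₀ × G₁) := by
  obtain ⟨p, hle, hsep⟩ := Gen.exists_separating_ultrafilters
  refine ⟨Multiplicative (Gen.monoGroup p false), Multiplicative (Gen.monoGroup p true),
    inferInstance, inferInstance, inferInstance, inferInstanceAs (T2Space (Gen.monoGroup p false)),
    inferInstance, inferInstance, inferInstance, inferInstanceAs (T2Space (Gen.monoGroup p true)),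
    ?_, ?_, ?_⟩
  · exact isCountablyCompact_iff_countablyCompactSpace.1
      (Gen.isCountablyCompact_monoGroup hle false)
  · exact isCountablyCompact_iff_countablyCompactSpace.1
      (Gen.isCountablyCompact_monoGroup hle true)
  · exact Gen.not_countablyCompactSpace_prod_monoGroup (Gen.eval_injective hsep)
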